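/- Work in $\mathbb R^n$ with its Euclidean structure, and let $O(n)$ be its orthogonal group. Let $C(n)$ be the set of compact convex bodies $V\subset\mathbb R^n$ with nonempty interior that are symmetric about $0$ ($V=-V$), and let $\rho_H$ be the Hausdorff metric on $C(n)$. For $V\in C(n)$ the Löwner ellipsoid of $V$ is the ellipsoid centred at $0$ (a set $T(B^n)$ with $T\in GL(n)$, where $B^n$ is the closed unit ball) that contains $V$ and has minimal volume. Let $L(n)$ be the set of all $V\in C(n)$ whose Löwner ellipsoid is $B^n$, and let $L_E(n)=L(n)\setminus\{B^n\}$. The stabilizer of $V\in C(n)$ is $O(n)_V=\{g\in O(n): g(V)=V\}$. A compact convex set is called elliptically convex if the set of its extreme points equals its relative boundary, and non-elliptically convex otherwise. **Proposition 3.7.** Let $V\in L_E(n)$ and let $H=O(n)_V$ be its stabilizer. Then for every $\varepsilon>0$ there is a finite set $L\subset\operatorname{Bd}V$ with $0\in\operatorname{Int}(\operatorname{Conv}L)$ such that, writing $H\cdot L=\{h(x): h\in H,\ x\in L\}$ and $W=\operatorname{Conv}(H\cdot L)$: 1. $W\in C(n)$ and $W$ is non-elliptically convex; 2. $V$ and $W$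 have the same stabilizer, $O(n)_W=O(n)_V=H$; 3. $\rho_H(V,W)<\varepsilon$. -/

import Mathlib

namespace BanachMazur

/-- The Euclidean space `ℝⁿ`. -/
abbrev Euc (n : ℕ) : Type := EuclideanSpace ℝ (Fin n)

/-- The group `O(n)` of linear isometries of `ℝⁿ`; its product is composition. -/
abbrev On (n : ℕ) : Type := Euc n ≃ₗᵢ[ℝ] Euc n

/-- The group `GL(n)` of invertible linear maps of `ℝⁿ`; its product is composition. -/
abbrev GLn (n : ℕ) : Type := Euc n ≃ₗ[ℝ] Euc n

/-- The closed unit ball `Bⁿ`. -/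
def unitBall (n : ℕ) : Set (Euc n) := Metric.closedBall 0 1

/-- `C(n)`: the compact convex bodies (with nonempty interior) in `ℝⁿ` that are symmetric about
the origin. -/
structure IsSymmetricBody {n : ℕ} (V : Set (Euc n)) : Prop where
  isCompact : IsCompact V
  convex : Convex ℝ V
  interior_nonempty : (interior V).Nonempty
  neg_mem : ∀ x ∈ V, -x ∈ V

/-- The family `C(n)` as a set of subsets of `ℝⁿ`. -/
def bodies (n : ℕ) : Set (Set (Euc n)) := {V | IsSymmetricBody V}

/-- The ellipsoids centred at the origin: the orbit `GL(n) · Bⁿ`. -/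
def ellipsoids (n : ℕ) : Set (Set (Euc n)) := {E | ∃ T : GLn n, E = T '' unitBall n}

/-- `E` is a Löwner ellipsoid of `V`: an origin-centred ellipsoid that contains `V` and has minimal
Euclidean volume among all such ellipsoids. -/
structure IsLoewnerEllipsoid {n : ℕ} (E V : Set (Euc n)) : Prop where
  mem_ellipsoids : E ∈ ellipsoids n
  subset : V ⊆ E
  volume_le : ∀ E' ∈ ellipsoids n, V ⊆ E' → MeasureTheory.volume E ≤ MeasureTheory.volume E'

/-- `L(n)`: the bodies in `C(n)` whose Löwner ellipsoid is the unit ball `Bⁿ`. -/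
def loewnerSlice (n : ℕ) : Set (Set (Euc n)) :=
  {V | V ∈ bodies n ∧ IsLoewnerEllipsoid (unitBall n) V}

/-- `L_E(n) = L(n) \ {Bⁿ}`. -/
def loewnerSliceE (n : ℕ) : Set (Set (Euc n)) := loewnerSlice n \ {unitBall n}

/-- The stabilizer `O(n)_V = {g ∈ O(n) | g · V = V}`, where `g · V = g(V)`. -/
def orthStabilizer {n : ℕ} (V : Set (Euc n)) : Subgroup (On n) where
  carrier := {g | g '' V = V}
  one_mem' := by simp
  mul_mem' := by
    intro a b ha hb
    simp only [Set.mem_ofPred_eq] at ha hb ⊢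
    rw [LinearIsometryEquiv.coe_mul, Set.image_comp, hb, ha]
  inv_mem' := by
    intro a ha
    simp only [Set.mem_ofPred_eq] at ha ⊢
    calc (a⁻¹ : On n) '' V = (a⁻¹ : On n) '' (a '' V) := by rw [ha]
      _ = V := by rw [LinearIsometryEquiv.inv_def, Set.image_image]; simp

/-- `H · L = {h x | h ∈ H, x ∈ L}`. -/
def orbitSet {n : ℕ} (H : Subgroup (On n)) (L : Set (Euc n)) : Set (Euc n) :=
  {y | ∃ h ∈ H, ∃ x ∈ L, h x = y}

/-- A convex set is elliptically convex if its extreme points are exactly the points of its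
relative boundary. -/
def EllipticallyConvex {n : ℕ} (V : Set (Euc n)) : Prop :=
  Set.extremePoints ℝ V = intrinsicFrontier ℝ V

end BanachMazur

open MeasureTheory Topology Filter Set
open scoped Pointwise

/-! ### Closed subgroups near a given closed subgroup of a compact group. -/

namespace CompactGroup

/-! Take `L` to be a finite symmetric net in the boundary of `V` and `W` the hull of its `H`-orbit.
Symmetry, compactness and closeness to `V` are then direct, and `H` fixes `W`. Two points need an
argument.

The stabilizer of `W` must not exceed `H`. Bodies near `V` have stabilizers near `H` by compactness
of the orthogonal group, so it suffices that no closed subgroup `K` properly containing `H` lies in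
a small neighbourhood of `H`. Stone-Weierstrass, Haar averaging and Noetherianity give a
finite-dimensional space `F` of right `H`-invariant functions that cuts out `H`. Averaging over `K`
is idempotent on `F`, and near the identity if `K` is near `H`, hence equal to it. So all of `F` is
`K`-invariant and `K = H`.

`W` must not be elliptically convex. Extreme points of `W` lie in finitely many `H`-orbits; if they
filled the boundary, radial projection would cover the unit sphere by finitely many compact orbits.
Connectedness leaves a single orbit, so `V` is a ball, and its Löwner ellipsoid forces `V` to be the
unit ball, which is excluded. -/

theorem exists_mem_pow_of_mem_adjoin {B : Type*} [CommRing B] [Algebra ℝ B] (M : Submodule ℝ B)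
    (h1 : 1 ∈ M) (f : B) (hf : f ∈ Algebra.adjoin ℝ (M : Set B)) :
    ∃ d, f ∈ M ^ d := by
  have hle : (1 : Submodule ℝ B) ≤ M := Submodule.one_le.mpr h1
  induction hf using Algebra.adjoin_induction with
  | mem x hx => exact ⟨1, by simpa using hx⟩
  | algebraMap r =>
    refine ⟨1, ?_⟩
    rw [pow_one, Algebra.algebraMap_eq_smul_one]
    exact M.smul_mem r h1
  | add x y _ _ hx hy =>
    obtain ⟨a, ha⟩ := hx
    obtain ⟨b, hb⟩ := hy
    exact ⟨a + b, add_mem (pow_le_pow_right' hle (Nat.le_add_right a b) ha)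
      (pow_le_pow_right' hle (Nat.le_add_left b a) hb)⟩
  | mul x y _ _ hx hy =>
    obtain ⟨a, ha⟩ := hx
    obtain ⟨b, hb⟩ := hy
    exact ⟨a + b, by rw [pow_add]; exact Submodule.mul_mem_mul ha hb⟩

theorem pow_le_adjoin {B : Type*} [CommRing B] [Algebra ℝ B] (M : Submodule ℝ B)
    (d : ℕ) :
    M ^ d ≤ Subalgebra.toSubmodule (Algebra.adjoin ℝ (M : Set B)) := by
  induction d with
  | zero =>
    rw [pow_zero, Submodule.one_le]
    exact (Algebra.adjoin ℝ (M : Set B)).one_mem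
  | succ d ih =>
    rw [pow_succ, Submodule.mul_le]
    exact fun a ha b hb => (Algebra.adjoin ℝ (M : Set B)).mul_mem (ih ha)
      (Algebra.subset_adjoin hb)

variable {G : Type*} [Group G] [TopologicalSpace G] [IsTopologicalGroup G]

/-- Right translation `f ↦ (x ↦ f (x * g))` on the algebra of continuous functions. -/
noncomputable def rightTranslate (g : G) : C(G, ℝ) →ₐ[ℝ] C(G, ℝ) :=
  ContinuousMap.compRightAlgHom ℝ ℝ ⟨fun x => x * g, continuous_mul_const g⟩

@[simp]
theorem rightTranslate_apply (g x : G) (f : C(G, ℝ)) : rightTranslate g f x = f (x * g) := rfl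

theorem continuous_rightTranslate [CompactSpace G] [T2Space G] :
    Continuous fun p : G × C(G, ℝ) => rightTranslate p.1 p.2 := by
  refine ContinuousMap.continuous_of_continuous_uncurry _ ?_
  change Continuous fun q : (G × C(G, ℝ)) × G => q.1.2 (q.2 * q.1.1)
  fun_prop

theorem continuous_rightTranslate_left [CompactSpace G] [T2Space G] (f : C(G, ℝ)) :
    Continuous fun g : G => rightTranslate g f :=
  continuous_rightTranslate.comp (continuous_id.prodMk continuous_const)

/-- Averaging over a closed subgroup of a compact group. -/
theorem exists_average [CompactSpace G] [T2Space G] (K : Subgroup G)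
    (hK : IsClosed (K : Set G)) :
    ∃ A : C(G, ℝ) →ₗ[ℝ] C(G, ℝ),
      (∀ f, ∀ k ∈ K, rightTranslate k (A f) = A f) ∧
      ∀ f (S : Set C(G, ℝ)), Convex ℝ S → IsClosed S → (∀ k ∈ K, rightTranslate k f ∈ S) →
        A f ∈ S := by
  have : CompactSpace K := isCompact_iff_compactSpace.mp hK.isCompact
  borelize (K : Type _)
  let μ : Measure K := Measure.haarMeasure ⊤
  have : IsProbabilityMeasure μ := ⟨Measure.haarMeasure_self (K₀ := ⊤)⟩
  have hc : ∀ f : C(G, ℝ), Continuous fun k : K => rightTranslate (k : G) f := fun f =>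
    (continuous_rightTranslate_left f).comp continuous_subtype_val
  have hi : ∀ f : C(G, ℝ), Integrable (fun k : K => rightTranslate (k : G) f) μ := fun f =>
    (hc f).integrable_of_hasCompactSupport (HasCompactSupport.of_compactSpace _)
  let A : C(G, ℝ) →ₗ[ℝ] C(G, ℝ) :=
    { toFun := fun f => ∫ k : K, rightTranslate (k : G) f ∂μ
      map_add' := fun f g => by
        simp only [map_add]
        exact integral_add (hi f) (hi g)
      map_smul' := fun c f => by
        simp only [map_smul, RingHom.id_apply]
        exact integral_smul c _ }
  have hA : ∀ f x, A f x = ∫ k : K, f (x * k) ∂μ := fun f x =>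
    ((ContinuousMap.evalCLM ℝ x).integral_comp_comm (hi f)).symm
  refine ⟨A, fun f k hk => ?_, fun f S hS hSc h => ?_⟩
  · ext x
    rw [rightTranslate_apply, hA, hA]
    -- Left invariance of Haar measure on `K` absorbs the translation by `k`.
    rw [← integral_mul_left_eq_self (fun j : K => f (x * j)) ⟨k, hk⟩]
    simp [mul_assoc]
  · exact hS.integral_mem hSc (ae_of_all _ fun k => h k k.2) (hi f)

variable (M : Submodule ℝ C(G, ℝ))

/-- Being finite-dimensional, `M ^ d` is also closed, so averages of its elements remain in it; the
generated algebra itself need not be closed. -/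
theorem pow_invariant (hM : ∀ g, ∀ f ∈ M, rightTranslate g f ∈ M) (d : ℕ) (g : G) (f : C(G, ℝ))
    (hf : f ∈ M ^ d) : rightTranslate g f ∈ M ^ d := by
  have h : (M ^ d).map (rightTranslate g).toLinearMap ≤ M ^ d := by
    rw [Submodule.map_pow]
    refine pow_le_pow_left' ?_ d
    rintro _ ⟨f, hf, rfl⟩
    exact hM g f hf
  exact h ⟨f, hf, rfl⟩

variable {M}

/-- A closed subgroup is separated from the points outside it by invariant functions from a
point-separating algebra generated by a finite-dimensional invariant space. -/
theorem exists_invariant_separating [CompactSpace G] [T2Space G] [FiniteDimensional ℝ M]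
    (h1 : 1 ∈ M) (hM : ∀ g, ∀ f ∈ M, rightTranslate g f ∈ M)
    (hsep : (Algebra.adjoin ℝ (M : Set C(G, ℝ))).SeparatesPoints)
    (H : Subgroup G) (hH : IsClosed (H : Set G)) (g : G) (hg : g ∉ H) :
    ∃ p ∈ Algebra.adjoin ℝ (M : Set C(G, ℝ)), (∀ h ∈ H, rightTranslate h p = p) ∧ p g ≠ p 1 := by
  obtain ⟨A, hA1, hA2⟩ := exists_average H hH
  -- The preimage is the coset `gH`. A Urysohn function that is 0 on `H` and 1 on `gH`, approximated
  -- within 1/3, keeps averages at most 1/3 at `1` and at least 2/3 at `g`.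
  have hgH : IsClosed ((fun x => g⁻¹ * x) ⁻¹' (H : Set G)) := hH.preimage (continuous_const_mul _)
  have hdisj : Disjoint (H : Set G) ((fun x => g⁻¹ * x) ⁻¹' (H : Set G)) := by
    rw [Set.disjoint_left]
    intro x hx hx'
    have h2 : g⁻¹ * x ∈ H := hx'
    exact hg (inv_mem_iff.mp ((H.mul_mem_cancel_right hx).mp h2))
  obtain ⟨f, hf0, hf1, -⟩ := exists_continuous_zero_one_of_isClosed hH hgH hdisj
  have hf : f ∈ closure (Algebra.adjoin ℝ (M : Set C(G, ℝ)) : Set C(G, ℝ)) := by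
    rw [← Subalgebra.topologicalClosure_coe,
      ContinuousMap.subalgebra_topologicalClosure_eq_top_of_separatesPoints _ hsep]
    trivial
  obtain ⟨q, hq, hqf⟩ := Metric.mem_closure_iff.mp hf (1 / 3) (by norm_num)
  have hqx : ∀ x, |f x - q x| < 1 / 3 := fun x =>
    (ContinuousMap.dist_apply_le_dist x).trans_lt hqf
  obtain ⟨d, hd⟩ := exists_mem_pow_of_mem_adjoin M h1 q hq
  have : FiniteDimensional ℝ ↥(M ^ d) :=
    Module.Finite.iff_fg.mpr ((Module.Finite.iff_fg.mp ‹FiniteDimensional ℝ M›).pow d)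
  have hev : ∀ x : G, Continuous fun φ : C(G, ℝ) => φ x := fun x =>
    (ContinuousMap.evalCLM ℝ x).continuous
  refine ⟨A q, pow_le_adjoin M d ?_, hA1 q, ?_⟩
  · exact hA2 q (M ^ d : Submodule ℝ C(G, ℝ)) (Submodule.convex _)
      (Submodule.closed_of_finiteDimensional _) fun k _ => pow_invariant M hM d k q hd
  · have hlow : A q 1 ≤ 1 / 3 := by
      refine hA2 q {φ | φ 1 ≤ 1 / 3} ?_ (isClosed_le (hev 1) continuous_const) fun k hk => ?_
      · exact convex_halfSpace_le (ContinuousMap.evalCLM ℝ (1 : G)).toLinearMap.isLinear _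
      · have h := hqx k
        rw [show f k = 0 from hf0 hk, abs_lt] at h
        simp only [mem_ofPred_eq, rightTranslate_apply, one_mul]
        linarith
    have hhigh : 2 / 3 ≤ A q g := by
      refine hA2 q {φ | 2 / 3 ≤ φ g} ?_ (isClosed_le continuous_const (hev g)) fun k hk => ?_
      · exact convex_halfSpace_ge (ContinuousMap.evalCLM ℝ (g : G)).toLinearMap.isLinear _
      · have h := hqx (g * k)
        rw [show f (g * k) = 1 from hf1 (by simpa using hk), abs_lt] at h
        simp only [mem_ofPred_eq, rightTranslate_apply]
        linarith
    intro h
    rw [h] at hhigh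
    linarith

/-- Finitely many invariant functions suffice to cut out a closed subgroup. -/
theorem exists_pow_invariants_cut_out [CompactSpace G] [T2Space G] [FiniteDimensional ℝ M]
    (h1 : 1 ∈ M) (hM : ∀ g, ∀ f ∈ M, rightTranslate g f ∈ M)
    (hsep : (Algebra.adjoin ℝ (M : Set C(G, ℝ))).SeparatesPoints)
    (H : Subgroup G) (hH : IsClosed (H : Set G)) :
    ∃ d, ∀ g, (∀ p ∈ M ^ d, (∀ h ∈ H, rightTranslate h p = p) → p g = p 1) → g ∈ H := by
  classical
  set P := Algebra.adjoin ℝ (M : Set C(G, ℝ)) with hP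
  have hfg : P.FG := by
    obtain ⟨s, hs⟩ := Module.Finite.iff_fg.mp ‹FiniteDimensional ℝ M›
    refine ⟨s, ?_⟩
    rw [hP, ← hs, Algebra.adjoin_span]
  -- By Hilbert's basis theorem, finitely many differences `p - p 1` generate the ideal spanned by
  -- all of them, so a single degree bound suffices.
  have : IsNoetherianRing P := isNoetherianRing_of_fg hfg
  let T : Set P := {q | ∃ p : P, (∀ h ∈ H, rightTranslate h (p : C(G, ℝ)) = p) ∧
    q = p - algebraMap ℝ P ((p : C(G, ℝ)) 1)}
  obtain ⟨s, hsT, hs⟩ := (Submodule.fg_span_iff_fg_span_finset_subset T).mp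
    (IsNoetherian.noetherian (Submodule.span P T))
  have hsT' : ∀ q, q ∈ s → ∃ p : P, (∀ h ∈ H, rightTranslate h (p : C(G, ℝ)) = p) ∧
    q = p - algebraMap ℝ P ((p : C(G, ℝ)) 1) := fun q hq => hsT hq
  choose! p hpinv hpeq using hsT'
  have hdeg : ∃ d, ∀ q ∈ s, (p q : C(G, ℝ)) ∈ M ^ d := by
    choose e he using fun q : P => exists_mem_pow_of_mem_adjoin M h1 (q : C(G, ℝ)) q.2
    refine ⟨s.sup fun q => e (p q), fun q hq => ?_⟩
    exact pow_le_pow_right' (Submodule.one_le.mpr h1)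
      (Finset.le_sup (f := fun q => e (p q)) hq) (he (p q))
  obtain ⟨d, hd⟩ := hdeg
  refine ⟨d, fun g hg => ?_⟩
  by_contra hgH
  obtain ⟨r, hrP, hrinv, hr⟩ := exists_invariant_separating h1 hM hsep H hH g hgH
  let ev : P →+* ℝ := (ContinuousMap.evalAlgHom ℝ ℝ g).toRingHom.comp P.val.toRingHom
  have hle : Submodule.span P T ≤ RingHom.ker ev := by
    rw [hs, Submodule.span_le]
    intro q hq
    have h2 := hg (p q) (hd q hq) (hpinv q hq)
    have h3 : ev q = 0 := by
      rw [hpeq q hq]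
      change (p q : C(G, ℝ)) g - (p q : C(G, ℝ)) 1 = 0
      rw [h2, sub_self]
    exact h3
  have h4 : (⟨r, hrP⟩ : P) - algebraMap ℝ P (r 1) ∈ RingHom.ker ev :=
    hle (Submodule.subset_span ⟨⟨r, hrP⟩, hrinv, rfl⟩)
  have h5 : r g - r 1 = 0 := h4
  exact hr (sub_eq_zero.mp h5)

/-- A closed subgroup `H` has a neighbourhood in which no closed subgroup properly contains `H`. -/
theorem exists_isOpen_forall_subgroup_eq [CompactSpace G] [T2Space G] [FiniteDimensional ℝ M]
    (h1 : 1 ∈ M) (hM : ∀ g, ∀ f ∈ M, rightTranslate g f ∈ M)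
    (hsep : (Algebra.adjoin ℝ (M : Set C(G, ℝ))).SeparatesPoints)
    (H : Subgroup G) (hH : IsClosed (H : Set G)) :
    ∃ U : Set G, IsOpen U ∧ (H : Set G) ⊆ U ∧ ∀ K : Subgroup G, IsClosed (K : Set G) →
      H ≤ K → (K : Set G) ⊆ U → K = H := by
  obtain ⟨d, hd⟩ := exists_pow_invariants_cut_out h1 hM hsep H hH
  have : FiniteDimensional ℝ ↥(M ^ d) :=
    Module.Finite.iff_fg.mpr ((Module.Finite.iff_fg.mp ‹FiniteDimensional ℝ M›).pow d)
  let F : Submodule ℝ C(G, ℝ) :=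
    M ^ d ⊓ ⨅ h ∈ H, LinearMap.ker ((rightTranslate h).toLinearMap - LinearMap.id)
  have hF : ∀ f, f ∈ F ↔ f ∈ M ^ d ∧ ∀ h ∈ H, rightTranslate h f = f := by
    intro f
    simp [F, Submodule.mem_iInf, sub_eq_zero]
  have : FiniteDimensional ℝ F := Submodule.finiteDimensional_of_le (inf_le_left)
  -- The unit sphere of `F` is compact, which makes `U` open; any bound below 1 would serve in place
  -- of 1/2.
  let S : Set C(G, ℝ) := Subtype.val '' Metric.sphere (0 : F) 1
  have hS : IsCompact S := (isCompact_sphere (0 : F) 1).image continuous_subtype_val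
  let U : Set G := {g | ∀ f ∈ S, ‖rightTranslate g f - f‖ < 1 / 2}
  have hU : IsOpen U := by
    rw [isOpen_iff_mem_nhds]
    intro g hg
    refine hS.eventually_forall_of_forall_eventually fun f hf => ?_
    have hcont : Continuous fun z : G × C(G, ℝ) => ‖rightTranslate z.1 z.2 - z.2‖ :=
      (continuous_rightTranslate.sub continuous_snd).norm
    exact (hcont.tendsto (g, f)).eventually (gt_mem_nhds (hg f hf))
  refine ⟨U, hU, ?_, fun K hK hHK hKU => le_antisymm ?_ hHK⟩
  · rintro h hh _ ⟨f, -, rfl⟩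
    rw [((hF f).mp f.2).2 h hh]
    simp
  obtain ⟨A, hA1, hA2⟩ := exists_average K hK
  have hnorm : ∀ f ∈ F, ‖A f - f‖ ≤ 1 / 2 * ‖f‖ := by
    intro f hf
    rcases eq_or_ne f 0 with rfl | hf0
    · simp
    have hpos : 0 < ‖f‖ := norm_pos_iff.mpr hf0
    have := hA2 f (Metric.closedBall f (1 / 2 * ‖f‖)) (convex_closedBall _ _)
      Metric.isClosed_closedBall fun k hk => by
        have hmem : ‖f‖⁻¹ • f ∈ S :=
          ⟨⟨‖f‖⁻¹ • f, F.smul_mem _ hf⟩, by simp [norm_smul, hpos.ne'], rfl⟩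
        have h := hKU hk _ hmem
        rw [map_smul, ← smul_sub, norm_smul, norm_inv, norm_norm] at h
        rw [mem_closedBall_iff_norm]
        rw [inv_mul_lt_iff₀ hpos] at h
        linarith
    rwa [mem_closedBall_iff_norm] at this
  have hAF : ∀ f ∈ F, A f ∈ F := by
    intro f hf
    rw [hF]
    refine ⟨?_, fun h hh => hA1 f h (hHK hh)⟩
    exact hA2 f (M ^ d : Submodule ℝ C(G, ℝ)) (Submodule.convex _)
      (Submodule.closed_of_finiteDimensional _)
      fun k _ => pow_invariant M hM d k f ((hF f).mp hf).1
  have hAA : ∀ f, A (A f) = A f := fun f =>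
    hA2 (A f) {A f} (convex_singleton _) isClosed_singleton fun k hk => hA1 f k hk
  have hAid : ∀ f ∈ F, A f = f := by
    intro f hf
    -- `A` kills `f - A f`, so the estimate reads `‖f - A f‖ ≤ ‖f - A f‖ / 2`.
    have h := hnorm (f - A f) (F.sub_mem hf (hAF f hf))
    rw [map_sub, hAA, sub_self, zero_sub, norm_neg] at h
    have h0 : ‖f - A f‖ = 0 := le_antisymm (by linarith [norm_nonneg (f - A f)]) (norm_nonneg _)
    exact (sub_eq_zero.mp (norm_eq_zero.mp h0)).symm
  intro k hk
  refine hd k fun p hp hpinv => ?_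
  have hpF := hAid p ((hF p).mpr ⟨hp, hpinv⟩)
  have h := hA1 p k hk
  rw [hpF] at h
  have h2 := DFunLike.congr_fun h 1
  simpa using h2

end CompactGroup

/-! ### The orthogonal group as a compact linear group. -/

namespace OrthogonalGroup

variable {E : Type*} [NormedAddCommGroup E] [InnerProductSpace ℝ E] [FiniteDimensional ℝ E]

instance : CompactSpace (unitary (E →L[ℝ] E)) := by
  have : FiniteDimensional ℝ (E →L[ℝ] E) := inferInstance
  have : ProperSpace (E →L[ℝ] E) := FiniteDimensional.proper ℝ _
  refine isCompact_iff_compactSpace.mp (Metric.isCompact_of_isClosed_isBounded isClosed_unitary ?_)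
  refine (Metric.isBounded_closedBall (x := (0 : E →L[ℝ] E)) (r := 1)).subset fun u hu => ?_
  rw [mem_closedBall_zero_iff]
  refine ContinuousLinearMap.opNorm_le_bound _ zero_le_one fun x => ?_
  rw [one_mul]
  exact (Unitary.norm_map ⟨u, hu⟩ x).le

theorem continuous_inv_unitary : Continuous fun u : unitary (E →L[ℝ] E) => u⁻¹ := continuous_inv

/-- The affine functions of the entries, as continuous functions on the orthogonal group. -/
noncomputable def affineCoordinates :
    (StrongDual ℝ (E →L[ℝ] E) × ℝ) →ₗ[ℝ] C(unitary (E →L[ℝ] E), ℝ) where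
  toFun p := ⟨fun u => p.1 u + p.2, by fun_prop⟩
  map_add' p q := by
    ext u
    simp
    ring
  map_smul' c p := by
    ext u
    simp
    ring

/-- A closed subgroup `H` of the orthogonal group has a neighbourhood in which no closed subgroup
properly contains `H`. -/
theorem exists_isOpen_forall_subgroup_eq (H : Subgroup (unitary (E →L[ℝ] E)))
    (hH : IsClosed (H : Set (unitary (E →L[ℝ] E)))) :
    ∃ U : Set (unitary (E →L[ℝ] E)), IsOpen U ∧ (H : Set _) ⊆ U ∧
      ∀ K : Subgroup (unitary (E →L[ℝ] E)), IsClosed (K : Set (unitary (E →L[ℝ] E))) →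
        H ≤ K → (K : Set _) ⊆ U → K = H := by
  have hfd : FiniteDimensional ℝ (StrongDual ℝ (E →L[ℝ] E)) := inferInstance
  refine CompactGroup.exists_isOpen_forall_subgroup_eq
    (M := LinearMap.range (affineCoordinates (E := E))) ⟨(0, 1), ?_⟩ ?_ ?_ H hH
  · ext u
    simp [affineCoordinates]
  · rintro g _ ⟨p, rfl⟩
    refine ⟨(p.1.comp ((ContinuousLinearMap.compL ℝ E E E).flip (g : E →L[ℝ] E)), p.2), ?_⟩
    ext u
    rfl
  · intro u v huv
    obtain ⟨φ, hφ⟩ : ∃ φ : StrongDual ℝ (E →L[ℝ] E), φ u ≠ φ v :=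
      SeparatingDual.exists_separating_of_ne fun h => huv (Subtype.ext h)
    refine ⟨_, ⟨affineCoordinates (φ, 0), Algebra.subset_adjoin ⟨_, rfl⟩, rfl⟩, ?_⟩
    simpa [affineCoordinates] using hφ

end OrthogonalGroup

/-- In finite dimension the convex hull of a compact set is compact. -/
theorem IsCompact.isCompact_convexHull_of_finiteDimensional {E : Type*} [NormedAddCommGroup E]
    [NormedSpace ℝ E] [FiniteDimensional ℝ E] {s : Set E} (hs : IsCompact s) :
    IsCompact (convexHull ℝ s) := by
  let d := Module.finrank ℝ E + 1
  let Φ : ∀ k : ℕ, (Fin k → ℝ) × (Fin k → E) → E := fun k p => ∑ i, p.1 i • p.2 i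
  have hΦ : ∀ k, Continuous (Φ k) := fun k => by
    change Continuous fun p : (Fin k → ℝ) × (Fin k → E) => ∑ i, p.1 i • p.2 i
    fun_prop
  -- Carathéodory: boundedly many points suffice, so the hull is a finite union of continuous images
  -- of compact sets.
  have key : convexHull ℝ s =
      ⋃ k ∈ Finset.range (d + 1), Φ k '' (stdSimplex ℝ (Fin k) ×ˢ Set.pi univ fun _ => s) := by
    apply Subset.antisymm
    · intro x hx
      obtain ⟨ι, _, z, w, hz, hind, hw, hw1, rfl⟩ := eq_pos_convex_span_of_mem_convexHull hx
      have hcard : Fintype.card ι ≤ d :=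
        hind.card_le_finrank_succ.trans (Nat.succ_le_succ (Submodule.finrank_le _))
      let e := Fintype.equivFin ι
      simp only [mem_iUnion]
      refine ⟨Fintype.card ι, Finset.mem_range.mpr (Nat.lt_succ_of_le hcard),
        (fun i => w (e.symm i), fun i => z (e.symm i)), ⟨⟨fun i => (hw _).le, ?_⟩, ?_⟩, ?_⟩
      · rw [← hw1]
        exact e.symm.sum_comp w
      · exact fun i _ => hz ⟨_, rfl⟩
      · exact e.symm.sum_comp fun i => w i • z i
    · simp only [iUnion_subset_iff]
      rintro k - _ ⟨p, ⟨hp, hps⟩, rfl⟩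
      exact (convex_convexHull ℝ s).sum_mem (fun i _ => hp.1 i) hp.2
        fun i _ => subset_convexHull ℝ s (hps i trivial)
  rw [key]
  exact (Finset.range (d + 1)).isCompact_biUnion fun k _ =>
    ((isCompact_stdSimplex ℝ (Fin k)).prod (isCompact_univ_pi fun _ => hs)).image (hΦ k)

/-! ### Stabilizers and orbits in the orthogonal group. -/

namespace BanachMazur

variable {n : ℕ}

/-- A subgroup of `O(n)` as a group of unitary operators, which carry the norm topology. -/
noncomputable def toUnitary (H : Subgroup (On n)) : Subgroup (unitary (Euc n →L[ℝ] Euc n)) :=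
  H.comap Unitary.linearIsometryEquiv.toMonoidHom

theorem mem_toUnitary {H : Subgroup (On n)} {u : unitary (Euc n →L[ℝ] Euc n)} :
    u ∈ toUnitary H ↔ Unitary.linearIsometryEquiv u ∈ H := Iff.rfl

theorem toUnitary_injective : Function.Injective (toUnitary (n := n)) :=
  Subgroup.comap_injective Unitary.linearIsometryEquiv.surjective

theorem mem_orthStabilizer {V : Set (Euc n)} {g : On n} : g ∈ orthStabilizer V ↔ g '' V = V :=
  Iff.rfl

theorem mem_orthStabilizer_iff_forall {V : Set (Euc n)} {g : On n} :
    g ∈ orthStabilizer V ↔ (∀ x ∈ V, g x ∈ V) ∧ ∀ x ∈ V, g⁻¹ x ∈ V := by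
  constructor
  · intro h
    refine ⟨fun x hx => h ▸ mem_image_of_mem g hx, fun x hx => ?_⟩
    have h2 := inv_mem h
    exact (mem_orthStabilizer.mp h2) ▸ mem_image_of_mem _ hx
  · rintro ⟨h1, h2⟩
    refine Subset.antisymm (image_subset_iff.mpr h1) fun x hx => ⟨g⁻¹ x, h2 x hx, ?_⟩
    exact g.apply_symm_apply x

theorem continuous_unitary_apply (x : Euc n) :
    Continuous fun u : unitary (Euc n →L[ℝ] Euc n) => Unitary.linearIsometryEquiv u x := by
  change Continuous fun u : unitary (Euc n →L[ℝ] Euc n) => (u : Euc n →L[ℝ] Euc n) x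
  fun_prop

theorem isClosed_toUnitary_orthStabilizer {V : Set (Euc n)} (hV : IsClosed V) :
    IsClosed (toUnitary (orthStabilizer V) : Set (unitary (Euc n →L[ℝ] Euc n))) := by
  have : (toUnitary (orthStabilizer V) : Set (unitary (Euc n →L[ℝ] Euc n))) =
      (⋂ x ∈ V, (fun u => Unitary.linearIsometryEquiv u x) ⁻¹' V) ∩
        ⋂ x ∈ V, (fun u => Unitary.linearIsometryEquiv u⁻¹ x) ⁻¹' V := by
    ext u
    simp only [SetLike.mem_coe, mem_toUnitary, mem_orthStabilizer_iff_forall, map_inv, mem_inter_iff,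
      mem_iInter, mem_preimage]
  rw [this]
  exact (isClosed_biInter fun x _ => hV.preimage (continuous_unitary_apply x)).inter
    (isClosed_biInter fun x _ => hV.preimage ((continuous_unitary_apply x).comp OrthogonalGroup.continuous_inv_unitary))

/-- `H x` as a set. -/
theorem orbitSet_singleton_eq (H : Subgroup (On n)) (x : Euc n) :
    orbitSet H {x} =
      (fun u => Unitary.linearIsometryEquiv u x) '' 
        (toUnitary H : Set (unitary (Euc n →L[ℝ] Euc n))) := by
  ext y
  constructor
  · rintro ⟨h, hh, z, rfl, rfl⟩
    refine ⟨Unitary.linearIsometryEquiv.symm h, ?_, ?_⟩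
    · rw [SetLike.mem_coe, mem_toUnitary, MulEquiv.apply_symm_apply]
      exact hh
    · simp only [MulEquiv.apply_symm_apply]
  · rintro ⟨u, hu, rfl⟩
    exact ⟨_, hu, x, rfl, rfl⟩

theorem isCompact_orbitSet_singleton {H : Subgroup (On n)}
    (hH : IsClosed (toUnitary H : Set (unitary (Euc n →L[ℝ] Euc n)))) (x : Euc n) :
    IsCompact (orbitSet H {x}) := by
  rw [orbitSet_singleton_eq]
  exact hH.isCompact.image (continuous_unitary_apply x)

theorem orbitSet_eq_biUnion (H : Subgroup (On n)) (L : Set (Euc n)) :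
    orbitSet H L = ⋃ x ∈ L, orbitSet H {x} := by
  ext y
  simp [orbitSet]
  tauto

theorem isCompact_orbitSet {H : Subgroup (On n)}
    (hH : IsClosed (toUnitary H : Set (unitary (Euc n →L[ℝ] Euc n)))) {L : Set (Euc n)}
    (hL : L.Finite) : IsCompact (orbitSet H L) := by
  rw [orbitSet_eq_biUnion]
  exact hL.isCompact_biUnion fun x _ => isCompact_orbitSet_singleton hH x

/-- Bodies close to `V` have their stabilizers close to the stabilizer of `V`. -/
theorem exists_pos_forall_orthStabilizer_subset {V : Set (Euc n)} (hV : IsCompact V)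
    (hVne : V.Nonempty) {U : Set (unitary (Euc n →L[ℝ] Euc n))} (hU : IsOpen U)
    (hVU : (toUnitary (orthStabilizer V) : Set _) ⊆ U) :
    ∃ δ > 0, ∀ W : Set (Euc n), Bornology.IsBounded W → W.Nonempty →
      Metric.hausdorffDist V W < δ → (toUnitary (orthStabilizer W) : Set _) ⊆ U := by
  obtain ⟨R, hR⟩ := hV.isBounded.exists_norm_le
  obtain ⟨x₀, hx₀⟩ := hVne
  have hR0 : 0 ≤ R := (norm_nonneg _).trans (hR x₀ hx₀)
  let im : unitary (Euc n →L[ℝ] Euc n) → Set (Euc n) := fun u => Unitary.linearIsometryEquiv u '' V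
  have him : ∀ u, IsCompact (im u) := fun u => hV.image (LinearIsometryEquiv.continuous _)
  have hne : ∀ u, (im u).Nonempty := fun u => Set.Nonempty.image _ ⟨x₀, hx₀⟩
  have hfin : ∀ u v, Metric.hausdorffEDist (im u) (im v) ≠ ⊤ := fun u v =>
    Metric.hausdorffEDist_ne_top_of_nonempty_of_bounded (hne u) (hne v) (him u).isBounded
      (him v).isBounded
  let f : unitary (Euc n →L[ℝ] Euc n) → ℝ := fun u => Metric.hausdorffDist (im u) V
  have h1 : im 1 = V := by simp [im]
  have hclose : ∀ u v, Metric.hausdorffDist (im u) (im v) ≤ R * dist u v := by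
    have haux : ∀ u v : unitary (Euc n →L[ℝ] Euc n), ∀ x ∈ V,
        dist (Unitary.linearIsometryEquiv u x) (Unitary.linearIsometryEquiv v x) ≤
          R * dist u v := by
      intro u v x hx
      rw [dist_eq_norm]
      change ‖(u : Euc n →L[ℝ] Euc n) x - (v : Euc n →L[ℝ] Euc n) x‖ ≤ _
      rw [← sub_apply, Subtype.dist_eq, dist_eq_norm, mul_comm]
      exact (ContinuousLinearMap.le_opNorm _ _).trans
        (mul_le_mul_of_nonneg_left (hR x hx) (norm_nonneg _))
    intro u v
    refine Metric.hausdorffDist_le_of_mem_dist (mul_nonneg hR0 dist_nonneg) ?_ ?_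
    · rintro _ ⟨x, hx, rfl⟩
      exact ⟨_, ⟨x, hx, rfl⟩, haux u v x hx⟩
    · rintro _ ⟨x, hx, rfl⟩
      exact ⟨_, ⟨x, hx, rfl⟩, dist_comm u v ▸ haux v u x hx⟩
  have hf : Continuous f := by
    have hlip : LipschitzWith (Real.toNNReal R) f := by
      refine LipschitzWith.of_le_add_mul _ fun u v => ?_
      have h := Metric.hausdorffDist_triangle (hfin u v) (u := V)
      rw [Real.coe_toNNReal R hR0]
      have := hclose u v
      simp only [f]
      linarith
    exact hlip.continuous
  have hpos : ∀ u ∈ Uᶜ, 0 < f u := by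
    intro u hu
    refine lt_of_le_of_ne Metric.hausdorffDist_nonneg fun h => hu (hVU ?_)
    have h2 := (Metric.hausdorffDist_zero_iff_closure_eq_closure
      (h1 ▸ hfin u 1 : Metric.hausdorffEDist (im u) V ≠ ⊤)).mp h.symm
    rw [(him u).isClosed.closure_eq, hV.isClosed.closure_eq] at h2
    exact h2
  have hUc : IsCompact Uᶜ := hU.isClosed_compl.isCompact
  -- Off `U` the distance from `u V` to `V` has a positive minimum. If `u` fixes `W`, that distance
  -- is at most twice the distance from `V` to `W`, hence the choice `c / 2`.
  obtain ⟨c, hc, hcf⟩ : ∃ c > 0, ∀ u ∈ Uᶜ, c ≤ f u := by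
    rcases Uᶜ.eq_empty_or_nonempty with h | h
    · exact ⟨1, one_pos, by simp [h]⟩
    · obtain ⟨u, hu, hmin⟩ := hUc.exists_isMinOn h hf.continuousOn
      exact ⟨f u, hpos u hu, fun v hv => hmin hv⟩
  refine ⟨c / 2, half_pos hc, fun W hWb hWne hVW u hu => ?_⟩
  by_contra huU
  have hVWfin : Metric.hausdorffEDist W V ≠ ⊤ :=
    Metric.hausdorffEDist_ne_top_of_nonempty_of_bounded hWne ⟨x₀, hx₀⟩ hWb hV.isBounded
  have huW : Unitary.linearIsometryEquiv u '' W = W := hu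
  have hd : Metric.hausdorffDist (im u) W = Metric.hausdorffDist V W := by
    conv_lhs => rw [← huW]
    exact Metric.hausdorffDist_image (LinearIsometryEquiv.isometry _)
  have h3 := Metric.hausdorffDist_triangle' hVWfin (s := im u)
  rw [hd, Metric.hausdorffDist_comm (s := W)] at h3
  have := hcf u huU
  simp only [f] at this
  linarith

end BanachMazur

theorem neg_eq_self_of_neg_mem {E : Type*} [InvolutiveNeg E] {V : Set E} (hneg : ∀ x ∈ V, -x ∈ V) : -V = V := by
  refine Subset.antisymm (fun y hy => ?_) fun y hy => hneg y hy
  have := hneg _ hy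
  rwa [neg_neg] at this

/-! ### Boundaries, nets and hulls of convex bodies. -/

section ConvexBodies

variable {E : Type*} [NormedAddCommGroup E] [NormedSpace ℝ E]

/-- An interior point `x` is the midpoint of `x + t v` and `x - t v` for small nonzero `t`. -/
theorem extremePoints_subset_frontier [Nontrivial E] {V : Set E} (hV : IsClosed V) :
    V.extremePoints ℝ ⊆ frontier V := by
  intro x hx
  rw [hV.frontier_eq]
  refine ⟨hx.1, fun hxi => ?_⟩
  obtain ⟨v, hv⟩ := exists_ne (0 : E)
  have hc : ∀ c : ℝ, Tendsto (fun t : ℝ => x + (c * t) • v) (𝓝[≠] 0) (𝓝 x) := fun c => by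
    have h : Continuous fun t : ℝ => x + (c * t) • v := by fun_prop
    simpa using (h.tendsto 0).mono_left nhdsWithin_le_nhds
  have hmem := mem_interior_iff_mem_nhds.mp hxi
  obtain ⟨t, ⟨h1, h2⟩, ht⟩ := (((hc 1).eventually_mem hmem).and
    ((hc (-1)).eventually_mem hmem)).and self_mem_nhdsWithin |>.exists
  have h := (mem_extremePoints.mp hx).2 _ h1 _ h2
    ⟨1 / 2, 1 / 2, by norm_num, by norm_num, by norm_num, by module⟩
  have h3 : (1 * t) • v = 0 := by simpa using h.1
  rw [one_mul] at h3
  exact (smul_eq_zero.mp h3).elim ht hv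

theorem frontier_subset_intrinsicFrontier [FiniteDimensional ℝ E] {W : Set E} (hW : IsClosed W)
    (hconv : Convex ℝ W) (hne : (interior W).Nonempty) : frontier W ⊆ intrinsicFrontier ℝ W := by
  have hspan := hconv.interior_nonempty_iff_affineSpan_eq_top.mp hne
  rw [hW.frontier_eq, ← intrinsicClosure_sdiff_intrinsicInterior]
  refine sdiff_subset_sdiff subset_intrinsicClosure ?_
  have hopen : IsOpen (affineSpan ℝ W : Set E) := by
    rw [hspan]
    exact isOpen_univ
  refine interior_maximal intrinsicInterior_subset ?_
  exact hopen.isOpenMap_subtype_val _ isOpen_interior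

theorem zero_mem_interior_of_neg_mem {V : Set E} (hV : Convex ℝ V) (hne : (interior V).Nonempty)
    (hneg : ∀ x ∈ V, -x ∈ V) : (0 : E) ∈ interior V := by
  obtain ⟨x, hx⟩ := hne
  have hVneg : -V = V := neg_eq_self_of_neg_mem hneg
  have hx' : -x ∈ interior V := by
    have h : -x ∈ -interior V := by simpa using hx
    have h2 : -interior V ⊆ interior V := by
      refine interior_maximal ?_ isOpen_interior.neg
      intro y hy
      rw [← hVneg]
      exact interior_subset (s := V) (Set.mem_neg.mp hy)
    exact h2 h
  have := hV.interior hx hx' (by norm_num : (0 : ℝ) ≤ 1 / 2) (by norm_num : (0 : ℝ) ≤ 1 / 2)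
    (by norm_num)
  simpa using this

theorem convexHull_neg_mem {L : Set E} (hL : ∀ x ∈ L, -x ∈ L) :
    ∀ x ∈ convexHull ℝ L, -x ∈ convexHull ℝ L := by
  have h : convexHull ℝ L ⊆ -convexHull ℝ L :=
    convexHull_min (fun x hx => subset_convexHull ℝ L (hL x hx)) (convex_convexHull ℝ L).neg
  exact fun x hx => h hx

/-- A net of the boundary is enough: the closed thickening of the hull is convex and contains the
extreme points of `V`, hence `V` by Krein-Milman. -/
theorem hausdorffDist_convexHull_le [Nontrivial E] {V S : Set E} (hV : IsCompact V)
    (hconv : Convex ℝ V) (hSV : S ⊆ V) {δ : ℝ} (hδ : 0 ≤ δ)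
    (hnet : ∀ x ∈ frontier V, ∃ y ∈ S, dist x y ≤ δ) :
    Metric.hausdorffDist V (convexHull ℝ S) ≤ δ := by
  have hsub : V ⊆ Metric.cthickening δ (convexHull ℝ S) := by
    rw [← closure_convexHull_extremePoints hV hconv]
    refine closure_minimal (convexHull_min (fun x hx => ?_) ((convex_convexHull ℝ S).cthickening δ))
      Metric.isClosed_cthickening
    obtain ⟨y, hy, hxy⟩ := hnet x (extremePoints_subset_frontier hV.isClosed hx)
    exact Metric.mem_cthickening_of_dist_le x y δ _ (subset_convexHull ℝ S hy) hxy
  refine Metric.hausdorffDist_le_of_infDist hδ (fun x hx => ?_) fun x hx => ?_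
  · exact ENNReal.toReal_le_of_le_ofReal hδ (Metric.mem_cthickening_iff.mp (hsub hx))
  · rw [Metric.infDist_zero_of_mem (convexHull_min hSV hconv hx)]
    exact hδ

theorem exists_finite_net_frontier [FiniteDimensional ℝ E] [Nontrivial E] {V : Set E}
    (hV : IsCompact V) (hconv : Convex ℝ V) (hne : (interior V).Nonempty)
    (hneg : ∀ x ∈ V, -x ∈ V) {δ : ℝ} (hδ : 0 < δ) :
    ∃ L : Set E, L.Finite ∧ L ⊆ frontier V ∧ (∀ x ∈ L, -x ∈ L) ∧
      0 ∈ interior (convexHull ℝ L) ∧ ∀ x ∈ frontier V, ∃ y ∈ L, dist x y ≤ δ := by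
  have hfr : IsCompact (frontier V) :=
    hV.of_isClosed_subset isClosed_frontier hV.isClosed.frontier_subset
  have hVneg : -V = V := neg_eq_self_of_neg_mem hneg
  have hfneg : ∀ x ∈ frontier V, -x ∈ frontier V := by
    intro x hx
    have h : (Homeomorph.neg E) ⁻¹' frontier V = frontier ((Homeomorph.neg E) ⁻¹' V) :=
      (Homeomorph.neg E).preimage_frontier V
    have h2 : (Homeomorph.neg E) ⁻¹' V = V := hVneg
    rw [h2] at h
    rw [← h] at hx
    exact hx
  obtain ⟨F₁, hF₁, hF₁fin, hcov⟩ := hfr.finite_cover_balls hδ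
  -- When `δ` is large the net alone may not span; these points ensure that the hull has interior.
  obtain ⟨F₂, hF₂, hspan, hind⟩ := exists_affineIndependent ℝ E (frontier V)
  have hF₂fin : F₂.Finite := finite_set_of_fin_dim_affineIndependent ℝ hind
  have htop : affineSpan ℝ (frontier V) = ⊤ := by
    have hVtop := hconv.interior_nonempty_iff_affineSpan_eq_top.mp hne
    rw [eq_top_iff, ← hVtop]
    refine affineSpan_le.mpr ?_
    have h := closure_convexHull_extremePoints hV hconv
    intro x hx
    rw [← h] at hx
    refine closure_minimal ?_ (AffineSubspace.closed_of_finiteDimensional _) hx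
    exact (convexHull_subset_affineSpan _).trans
      (affineSpan_mono ℝ (extremePoints_subset_frontier hV.isClosed))
  let F := F₁ ∪ F₂
  have hF : F ⊆ frontier V := union_subset hF₁ hF₂
  have hFfin : F.Finite := hF₁fin.union hF₂fin
  have hLneg : ∀ x ∈ F ∪ -F, -x ∈ F ∪ -F := by
    rintro x (hx | hx)
    · exact Or.inr (by simpa using hx)
    · exact Or.inl hx
  refine ⟨F ∪ -F, hFfin.union hFfin.neg, union_subset hF fun x hx => ?_, hLneg, ?_, ?_⟩
  · have := hfneg _ (hF hx)
    rwa [neg_neg] at this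
  · refine zero_mem_interior_of_neg_mem (convex_convexHull ℝ _) ?_ (convexHull_neg_mem hLneg)
    rw [interior_convexHull_nonempty_iff_affineSpan_eq_top, eq_top_iff, ← htop, ← hspan]
    exact affineSpan_mono ℝ fun x hx => Or.inl (Or.inr hx)
  · intro x hx
    obtain ⟨y, hy, hxy⟩ := mem_iUnion₂.mp (hcov hx)
    exact ⟨y, Or.inl (Or.inl hy), (Metric.mem_ball.mp hxy).le⟩

theorem exists_pos_smul_mem_frontier {W : Set E} (hW : IsCompact W) (hconv : Convex ℝ W)
    (h0 : (0 : E) ∈ interior W) {u : E} (hu : u ≠ 0) : ∃ t : ℝ, 0 < t ∧ t • u ∈ frontier W := by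
  have hnhds : W ∈ 𝓝 (0 : E) := mem_interior_iff_mem_nhds.mp h0
  have hpos : 0 < gauge W u :=
    (gauge_pos (absorbent_nhds_zero hnhds)
      ((NormedSpace.isVonNBounded_iff ℝ).mpr hW.isBounded)).mpr hu
  refine ⟨(gauge W u)⁻¹, inv_pos.mpr hpos, ?_⟩
  rw [← gauge_eq_one_iff_mem_frontier hconv hnhds, gauge_smul_of_nonneg (inv_pos.mpr hpos).le,
    smul_eq_mul, inv_mul_cancel₀ hpos.ne']

end ConvexBodies

/-! ### Transitivity on the sphere and failure of elliptic convexity. -/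

namespace BanachMazur

variable {n : ℕ}

theorem neg_mem_orthStabilizer {V : Set (Euc n)} (hV : ∀ x ∈ V, -x ∈ V) :
    LinearIsometryEquiv.neg ℝ ∈ orthStabilizer V := by
  rw [mem_orthStabilizer_iff_forall]
  exact ⟨fun x hx => hV x hx, fun x hx => hV x hx⟩

theorem mem_orbitSet_singleton_symm {H : Subgroup (On n)} {x y : Euc n}
    (h : y ∈ orbitSet H {x}) : x ∈ orbitSet H {y} := by
  obtain ⟨g, hg, z, rfl, rfl⟩ := h
  exact ⟨g⁻¹, inv_mem hg, _, rfl, g.symm_apply_apply _⟩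

theorem mem_orbitSet_singleton_trans {H : Subgroup (On n)} {x y z : Euc n}
    (h₁ : y ∈ orbitSet H {x}) (h₂ : z ∈ orbitSet H {y}) : z ∈ orbitSet H {x} := by
  obtain ⟨g, hg, _, rfl, rfl⟩ := h₁
  obtain ⟨g', hg', _, rfl, rfl⟩ := h₂
  exact ⟨g' * g, mul_mem hg' hg, _, rfl, rfl⟩

/-- A closed subgroup of `O(n)` containing `-1` whose orbits through finitely many points cover
the unit sphere is transitive on the unit sphere. -/
theorem transitive_of_sphere_subset {H : Subgroup (On n)}
    (hH : IsClosed (toUnitary H : Set (unitary (Euc n →L[ℝ] Euc n))))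
    (hneg : LinearIsometryEquiv.neg ℝ ∈ H) {F : Set (Euc n)} (hF : F.Finite)
    (hcov : Metric.sphere 0 1 ⊆ orbitSet H F) {u v : Euc n} (hu : ‖u‖ = 1) (hv : ‖v‖ = 1) :
    v ∈ orbitSet H {u} := by
  rcases Nat.lt_or_ge 1 n with hn | hn
  · by_contra hvu
    have hrank : 1 < Module.rank ℝ (Euc n) := by
      rw [← Module.finrank_eq_rank, finrank_euclideanSpace_fin]
      exact_mod_cast hn
    -- The orbit of `u` and the union of the remaining orbits are disjoint closed sets covering a
    -- connected sphere.
    have hpre := isPreconnected_closed_iff.mp (isPreconnected_sphere hrank (0 : Euc n) 1)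
      (orbitSet H {u}) (orbitSet H {x ∈ F | x ∉ orbitSet H {u}})
      (isCompact_orbitSet_singleton hH u).isClosed
      (isCompact_orbitSet hH (hF.subset (sep_subset _ _))).isClosed
    have hsub : Metric.sphere 0 1 ⊆
        orbitSet H {u} ∪ orbitSet H {x ∈ F | x ∉ orbitSet H {u}} := by
      intro y hy
      obtain ⟨h, hh, x, hx, rfl⟩ := hcov hy
      by_cases hxu : x ∈ orbitSet H {u}
      · exact Or.inl (mem_orbitSet_singleton_trans hxu ⟨h, hh, x, rfl, rfl⟩)
      · exact Or.inr ⟨h, hh, x, ⟨hx, hxu⟩, rfl⟩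
    obtain ⟨y, -, hy₁, h, hh, x, ⟨-, hx⟩, rfl⟩ := hpre hsub
      ⟨u, by simpa using hu, 1, one_mem H, u, rfl, rfl⟩
      ⟨v, by simpa using hv, (hsub (by simpa using hv)).resolve_left hvu⟩
    exact hx (mem_orbitSet_singleton_trans hy₁
      (mem_orbitSet_singleton_symm ⟨h, hh, x, rfl, rfl⟩))
  -- The sphere is two points here, disconnected, and `-1` in `H` exchanges them.
  · have hn1 : n = 1 := by
      refine le_antisymm hn (Nat.one_le_iff_ne_zero.mpr ?_)
      rintro rfl
      rw [Subsingleton.elim u 0, norm_zero] at hu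
      exact zero_ne_one hu
    subst hn1
    have habs : ∀ x : Euc 1, ‖x‖ = |x 0| := fun x => by
      simp [EuclideanSpace.norm_eq, Real.sqrt_sq_eq_abs]
    have h2 : |v 0| = |u 0| := by rw [← habs, ← habs, hu, hv]
    rcases abs_eq_abs.mp h2 with h | h
    · refine ⟨1, one_mem H, u, rfl, ?_⟩
      ext i
      rw [Subsingleton.elim i 0, h]
      rfl
    · refine ⟨_, hneg, u, rfl, ?_⟩
      ext i
      rw [Subsingleton.elim i 0, h]
      rfl

/-- The stabilizer turns a vector of maximal norm in `V` into every direction, and star-convexity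
about `0` fills the ball. -/
theorem eq_closedBall_of_transitive [Nontrivial (Euc n)] {V : Set (Euc n)}
    (hV : IsSymmetricBody V)
    (htrans : ∀ u v : Euc n, ‖u‖ = 1 → ‖v‖ = 1 → v ∈ orbitSet (orthStabilizer V) {u}) :
    ∃ r > 0, V = Metric.closedBall 0 r := by
  have h0 : (0 : Euc n) ∈ interior V :=
    zero_mem_interior_of_neg_mem hV.convex hV.interior_nonempty hV.neg_mem
  obtain ⟨x, hxV, hmax⟩ := hV.isCompact.exists_isMaxOn ⟨0, interior_subset h0⟩
    continuous_norm.continuousOn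
  obtain ⟨w, hw⟩ := exists_ne (0 : Euc n)
  obtain ⟨t, ht, htw⟩ := exists_pos_smul_mem_frontier hV.isCompact hV.convex h0 hw
  have hx : 0 < ‖x‖ :=
    (norm_pos_iff.mpr (smul_ne_zero ht.ne' hw)).trans_le
      (hmax (hV.isCompact.isClosed.frontier_subset htw))
  refine ⟨‖x‖, hx, Subset.antisymm (fun y hy => ?_) fun y hy => ?_⟩
  · rw [mem_closedBall_zero_iff]
    exact hmax hy
  · rw [mem_closedBall_zero_iff] at hy
    rcases eq_or_ne y 0 with rfl | hy0
    · exact interior_subset h0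
    have hy' : 0 < ‖y‖ := norm_pos_iff.mpr hy0
    obtain ⟨g, hg, _, rfl, hgx⟩ := htrans (‖x‖⁻¹ • x) (‖y‖⁻¹ • y)
      (by simp [norm_smul, hx.ne']) (by simp [norm_smul, hy'.ne'])
    have hgV : g x ∈ V := (mem_orthStabilizer_iff_forall.mp hg).1 x hxV
    have heq : y = (‖y‖ * ‖x‖⁻¹) • g x := by
      rw [map_smul] at hgx
      rw [mul_smul, hgx, smul_smul, mul_inv_cancel₀ hy'.ne', one_smul]
    rw [heq]
    refine hV.convex.starConvex (interior_subset h0) |>.smul_mem hgV (by positivity) ?_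
    rw [← div_eq_mul_inv]
    exact div_le_one_of_le₀ hy hx.le

/-- Containment in the unit ball gives `r ≤ 1`. The ball of radius `r` is itself a competing
ellipsoid, so minimal volume gives `1 ≤ r ^ n`. -/
theorem eq_one_of_closedBall_mem_loewnerSlice [Nontrivial (Euc n)] {r : ℝ} (hr : 0 < r)
    (h : Metric.closedBall (0 : Euc n) r ∈ loewnerSlice n) : r = 1 := by
  obtain ⟨-, -, hsub, hvol⟩ := h
  apply le_antisymm
  · obtain ⟨u, hu⟩ := exists_norm_eq (Euc n) hr.le
    have := hsub (mem_closedBall_zero_iff.mpr hu.le)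
    rwa [unitBall, mem_closedBall_zero_iff, hu] at this
  · have hell : Metric.closedBall (0 : Euc n) r ∈ ellipsoids n := by
      refine ⟨LinearEquiv.smulOfNeZero ℝ (Euc n) r hr.ne', ?_⟩
      have h2 : (LinearEquiv.smulOfNeZero ℝ (Euc n) r hr.ne' : Euc n → Euc n) '' unitBall n =
          r • Metric.closedBall (0 : Euc n) 1 := rfl
      rw [h2, smul_closedBall _ _ zero_le_one, smul_zero, mul_one, Real.norm_of_nonneg hr.le]
    have hle := hvol _ hell Subset.rfl
    rw [unitBall, Measure.addHaar_closedBall _ _ zero_le_one,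
      Measure.addHaar_closedBall _ _ hr.le, one_pow,
      ENNReal.mul_le_mul_iff_left (Metric.measure_ball_pos volume _ one_pos).ne'
        measure_ball_lt_top.ne, ENNReal.ofReal_le_ofReal_iff (by positivity)] at hle
    exact (one_le_pow_iff_of_nonneg hr.le Module.finrank_pos.ne').mp hle

theorem not_ellipticallyConvex_convexHull_orbitSet [Nontrivial (Euc n)] {V : Set (Euc n)}
    (hV : V ∈ loewnerSliceE n) {L : Set (Euc n)} (hL : L.Finite)
    (h0 : 0 ∈ interior (convexHull ℝ (orbitSet (orthStabilizer V) L))) :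
    ¬ EllipticallyConvex (convexHull ℝ (orbitSet (orthStabilizer V) L)) := by
  intro hell
  have hbody : IsSymmetricBody V := hV.1.1
  have hH := isClosed_toUnitary_orthStabilizer hbody.isCompact.isClosed
  have hW := (isCompact_orbitSet hH hL).isCompact_convexHull_of_finiteDimensional
  have hfr : frontier (convexHull ℝ (orbitSet (orthStabilizer V) L)) ⊆
      orbitSet (orthStabilizer V) L := by
    refine (frontier_subset_intrinsicFrontier hW.isClosed (convex_convexHull ℝ _) ⟨0, h0⟩).trans ?_
    rw [← show _ = _ from hell]
    exact extremePoints_convexHull_subset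
  -- Isometries commute with normalization, so radial projection carries orbits to orbits.
  have hcov : Metric.sphere 0 1 ⊆
      orbitSet (orthStabilizer V) ((fun x => ‖x‖⁻¹ • x) '' L) := by
    intro u hu
    rw [mem_sphere_zero_iff_norm] at hu
    have hu0 : u ≠ 0 := norm_ne_zero_iff.mp (by rw [hu]; exact one_ne_zero)
    obtain ⟨t, ht, htu⟩ := exists_pos_smul_mem_frontier hW (convex_convexHull ℝ _) h0 hu0
    obtain ⟨h, hh, x, hx, hxu⟩ := hfr htu
    refine ⟨h, hh, _, ⟨x, hx, rfl⟩, ?_⟩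
    have hnorm : ‖x‖ = t := by
      rw [← h.norm_map x, hxu, norm_smul, hu, mul_one, Real.norm_of_nonneg ht.le]
    simp only [map_smul, hxu, hnorm]
    rw [smul_smul, inv_mul_cancel₀ ht.ne', one_smul]
  obtain ⟨r, hr, rfl⟩ := eq_closedBall_of_transitive hbody fun u v hu hv =>
    transitive_of_sphere_subset hH (neg_mem_orthStabilizer hbody.neg_mem) (hL.image _) hcov hu hv
  apply hV.2
  rw [mem_singleton_iff, eq_one_of_closedBall_mem_loewnerSlice hr hV.1]
  rfl

theorem le_orthStabilizer_convexHull_orbitSet (H : Subgroup (On n)) (L : Set (Euc n)) :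
    H ≤ orthStabilizer (convexHull ℝ (orbitSet H L)) := by
  have key : ∀ h ∈ H, ∀ x ∈ convexHull ℝ (orbitSet H L), h x ∈ convexHull ℝ (orbitSet H L) := by
    intro h hh x hx
    have h1 : h x ∈ (h.toLinearEquiv : Euc n →ₗ[ℝ] Euc n) '' convexHull ℝ (orbitSet H L) :=
      ⟨x, hx, rfl⟩
    rw [LinearMap.image_convexHull] at h1
    refine convexHull_mono ?_ h1
    rintro _ ⟨_, ⟨g, hg, y, hy, rfl⟩, rfl⟩
    exact ⟨h * g, mul_mem hh hg, y, hy, rfl⟩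
  exact fun h hh => mem_orthStabilizer_iff_forall.mpr ⟨key h hh, key h⁻¹ (inv_mem hh)⟩

end BanachMazur

/-! ### Choice of the net and conclusion. -/

theorem proposition3p7 (n : ℕ) (V : Set (BanachMazur.Euc n))
    (hV : V ∈ BanachMazur.loewnerSliceE n)
    (H : Subgroup (BanachMazur.On n)) (hH : H = BanachMazur.orthStabilizer V)
    (ε : ℝ) (hε : 0 < ε) :
    ∃ L : Set (BanachMazur.Euc n), L.Finite ∧ L ⊆ frontier V ∧
      0 ∈ interior (convexHull ℝ L) ∧
      ∃ W : Set (BanachMazur.Euc n), W = convexHull ℝ (BanachMazur.orbitSet H L) ∧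
        W ∈ BanachMazur.bodies n ∧
        ¬ BanachMazur.EllipticallyConvex W ∧
        BanachMazur.orthStabilizer W = BanachMazur.orthStabilizer V ∧
        Metric.hausdorffDist V W < ε := by
  open BanachMazur in
  have hbody : IsSymmetricBody V := hV.1.1
  have hVne : V.Nonempty := hbody.interior_nonempty.mono interior_subset
  -- For `n = 0` the only body is the unit ball, which is excluded.
  have hnt : Nontrivial (Euc n) := by
    by_contra hnt
    rw [not_nontrivial_iff_subsingleton] at hnt
    refine hV.2 ?_
    rw [mem_singleton_iff, Subsingleton.eq_univ_of_nonempty hVne]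
    exact (Subsingleton.eq_univ_of_nonempty ⟨0, by simp [unitBall]⟩).symm
  have hHc : IsClosed (toUnitary H : Set (unitary (Euc n →L[ℝ] Euc n))) :=
    hH ▸ isClosed_toUnitary_orthStabilizer hbody.isCompact.isClosed
  obtain ⟨U, hU, hHU, hsub⟩ := OrthogonalGroup.exists_isOpen_forall_subgroup_eq _ hHc
  obtain ⟨δ, hδ, hnear⟩ := exists_pos_forall_orthStabilizer_subset hbody.isCompact hVne hU
    (hH ▸ hHU)
  -- `δ` controls the stabilizer and `ε` the distance; halving turns the non-strict net bound into a
  -- strict one.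
  have hη : 0 < min δ ε / 2 := half_pos (lt_min hδ hε)
  obtain ⟨L, hLfin, hLfr, hLneg, hL0, hnet⟩ := exists_finite_net_frontier hbody.isCompact
    hbody.convex hbody.interior_nonempty hbody.neg_mem hη
  have hLorb : L ⊆ orbitSet H L := fun x hx => ⟨1, one_mem H, x, hx, rfl⟩
  have horbV : orbitSet H L ⊆ V := by
    rintro _ ⟨h, hh, x, hx, rfl⟩
    exact (mem_orthStabilizer_iff_forall.mp (hH ▸ hh)).1 x
      (hbody.isCompact.isClosed.frontier_subset (hLfr hx))
  have h0 : 0 ∈ interior (convexHull ℝ (orbitSet H L)) :=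
    interior_mono (convexHull_mono hLorb) hL0
  have hWc : IsCompact (convexHull ℝ (orbitSet H L)) :=
    (isCompact_orbitSet hHc hLfin).isCompact_convexHull_of_finiteDimensional
  have hdist : Metric.hausdorffDist V (convexHull ℝ (orbitSet H L)) ≤ min δ ε / 2 :=
    hausdorffDist_convexHull_le hbody.isCompact hbody.convex horbV hη.le
      fun x hx => (hnet x hx).imp fun y hy => ⟨hLorb hy.1, hy.2⟩
  have hlt : min δ ε / 2 < min δ ε := half_lt_self (lt_min hδ hε)
  refine ⟨L, hLfin, hLfr, hL0, _, rfl, ⟨hWc, convex_convexHull ℝ _, ⟨0, h0⟩,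
    convexHull_neg_mem ?_⟩, ?_, ?_, ?_⟩
  · rintro _ ⟨h, hh, x, hx, rfl⟩
    exact ⟨h, hh, -x, hLneg x hx, map_neg h x⟩
  · subst hH
    exact not_ellipticallyConvex_convexHull_orbitSet hV hLfin h0
  · rw [← hH]
    refine toUnitary_injective (hsub _ (isClosed_toUnitary_orthStabilizer hWc.isClosed)
      (Subgroup.comap_mono (le_orthStabilizer_convexHull_orbitSet H L))
      (hnear _ hWc.isBounded ⟨0, interior_subset h0⟩ ?_))
    exact hdist.trans_lt (hlt.trans_le (min_le_left _ _))
  · exact hdist.trans_lt (hlt.trans_le (min_le_right _ _))
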